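/- Let $q$ be a prime power and let $\mathbb F_q$ be the field of order $q$. For subspaces $U,V$ of $\mathbb F_q^n$ put $d_S(U,V)=\dim U+\dim V-2\dim(U\cap V)$. An $(n,d,k)_q$ constant dimension code is a set $\mathscr C$ of $k$-dimensional subspaces of $\mathbb F_q^n$ with $\min\{d_S(U,V) : U,V\in\mathscr C,\ U\ne V\}=d$. For $n\ge 2k$ and $1\le\delta\le k$, a lifted MRD code is a set $\{\mathrm{rowspace}(I_k\mid A) : A\in\mathcal D\}$, where $\mathcal D$ is an $\mathbb F_q$-linear space of $k\times(n-k)$ matrices over $\mathbb F_q$ with $|\mathcal D|=q^{(n-k)(k-\delta+1)}$ and $\mathrm{rank}(A-B)\ge\delta$ for all distinct $A,B\in\mathcal D$. Let $\overline A_q(n,2\delta,k)$ be the maximum size of an $(n,2\delta,k)_q$ constant dimension code which contains such a lifted MRD code as a subset. Then $$\overline A_q(19,8,6)\ \ge\ \begin{cases} q^{39}+q^{27}+q^{23}+2q^{21}+3q^{20}+4q^{19}+q^{18}+q^{17}+2q^{15}+2q^{13}+2q^{11}+q^{10}+q^{9}+2q^{7}+q^{4}+1, & q>2,\\[2pt]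 q^{39}+q^{27}+q^{23}+2q^{21}+3q^{20}+q^{19}+q^{17}+2q^{15}+2q^{13}+2q^{11}+q^{10}+q^{9}+2q^{7}+q^{4}+1, & q=2.\end{cases}$$ -/

import Mathlib

namespace ConstDimCode

/-- The subspace distance `d_S(U,V) = dim U + dim V - 2 dim (U ∩ V)`. The subtraction of natural
numbers never truncates, because `dim (U ∩ V)` is at most `dim U` and at most `dim V`. -/
noncomputable def subspaceDist {F : Type*} [Field F] {n : ℕ}
    (U V : Submodule F (Fin n → F)) : ℕ :=
  Module.finrank F U + Module.finrank F V - 2 * Module.finrank F ↥(U ⊓ V)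

/-- `C` is an `(n, M, d, k)_q` constant dimension code over the finite field `F` of order `q`:
a set of `M` subspaces of `F^n`, all of dimension `k`, with minimum subspace distance `d`. -/
def IsCDC (F : Type*) [Field F] (n M d k : ℕ) (C : Set (Submodule F (Fin n → F))) : Prop :=
  C.ncard = M ∧ (∀ U ∈ C, Module.finrank F U = k) ∧
    IsLeast {x : ℕ | ∃ U ∈ C, ∃ V ∈ C, U ≠ V ∧ x = subspaceDist U V} d

/-- `D` is a linear `[m × n, δ]_q` maximum rank distance code: a linear space of `m × n` matrices
with rank distance at least `δ` that attains the Singleton-like bound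
`q ^ (max m n * (min m n - δ + 1))`. -/
def IsLinearMRD (F : Type*) [Field F] (m n δ : ℕ)
    (D : Submodule F (Matrix (Fin m) (Fin n) F)) : Prop :=
  1 ≤ δ ∧ δ ≤ min m n ∧ (∀ A ∈ D, ∀ B ∈ D, A ≠ B → δ ≤ (A - B).rank) ∧
    Nat.card D = Nat.card F ^ (max m n * (min m n - δ + 1))

/-- The `k × n` matrix `(I_k | A)`, for a `k × (n - k)` matrix `A`. -/
def liftMatrix {F : Type*} [Field F] {n k : ℕ} (A : Matrix (Fin k) (Fin (n - k)) F) :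
    Matrix (Fin k) (Fin n) F :=
  Matrix.of fun i j =>
    if h : j.val < k then (if j.val = i.val then 1 else 0)
    else A i ⟨j.val - k, by have := j.isLt; omega⟩

/-- The row space of `(I_k | A)`, a subspace of `F^n`. -/
def lift {F : Type*} [Field F] {n k : ℕ} (A : Matrix (Fin k) (Fin (n - k)) F) :
    Submodule F (Fin n → F) :=
  Submodule.span F (Set.range (liftMatrix A).row)

/-- `L` is a lifted MRD code in `F^n`: `L = {rowspace (I_k | A) : A ∈ D}` for a linear
`[k × (n - k), δ]_q` MRD code `D`, where `n ≥ 2k`. -/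
def IsLiftedMRD (F : Type*) [Field F] (n δ k : ℕ) (L : Set (Submodule F (Fin n → F))) : Prop :=
  2 * k ≤ n ∧ ∃ D : Submodule F (Matrix (Fin k) (Fin (n - k)) F),
    IsLinearMRD F k (n - k) δ D ∧ L = {U | ∃ A ∈ D, U = lift A}

/-- The sizes `M` of the `(n, M, d, k)_q` constant dimension codes, with `d = 2δ`, that contain a
lifted MRD code of rank distance `δ` as a subset. -/
def sizesWithLiftedMRD (F : Type*) [Field F] (n d k : ℕ) : Set ℕ :=
  {M | ∃ C : Set (Submodule F (Fin n → F)), IsCDC F n M d k C ∧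
    ∃ δ, d = 2 * δ ∧ ∃ L, IsLiftedMRD F n δ k L ∧ L ⊆ C}

/-- The set of sizes is bounded, since `F^n` has finitely many subspaces. -/
theorem bddAbove_sizesWithLiftedMRD (F : Type*) [Field F] [Finite F] (n d k : ℕ) :
    BddAbove (sizesWithLiftedMRD F n d k) := by
  have : Finite (Submodule F (Fin n → F)) :=
    Finite.of_injective (fun U => (U : Set (Fin n → F))) SetLike.coe_injective
  refine ⟨Nat.card (Submodule F (Fin n → F)), ?_⟩
  rintro M ⟨C, ⟨rfl, -, -⟩, -⟩
  exact Set.ncard_le_card C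

/-- `Ā_q(n, d, k)`: the maximum size of an `(n, d, k)_q` constant dimension code over the field `F`
of order `q` that contains a lifted MRD code as a subset. -/
noncomputable def Abar (F : Type*) [Field F] (n d k : ℕ) : ℕ :=
  sSup (sizesWithLiftedMRD F n d k)

/-- Over a finite field the supremum in `Abar` is a maximum as soon as such a code exists. -/
theorem isGreatest_Abar (F : Type*) [Field F] [Finite F] (n d k : ℕ)
    (h : (sizesWithLiftedMRD F n d k).Nonempty) :
    IsGreatest (sizesWithLiftedMRD F n d k) (Abar F n d k) :=
  ⟨Nat.sSup_mem h (bddAbove_sizesWithLiftedMRD F n d k),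
    fun _ hM => le_csSup (bddAbove_sizesWithLiftedMRD F n d k) hM⟩

end ConstDimCode

/-! Split `F^19` as `P × F^13` with `P = F^6`. The codewords of the lifted MRD code are graphs of
maps `P → F^13` from a Gabidulin code, which gives `q^39` of them. Every other codeword projects to
a plane of `P` and meets `0 × F^13` in dimension 4, with leading entries in a prescribed 4-set of
positions. It meets a graph in dimension at most 2, since the projection to `P` is injective on a
graph.

Distance 8 means that distinct codewords meet in dimension at most 2. By
`finrank_inf_le_of_hasShape`, the intersection of two added codewords is at most the intersection of
their planes plus the number of common leading positions. It is thus enough that the planes are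
disjoint and the 4-sets share at most two positions, or that the 4-sets are disjoint. The planes
come from a partial spread, the 4-sets from the affine space `AG(3, 2)` and five further sets.

For one 4-set and one plane, `exists_family` puts a systematic Gabidulin code in the nonpivot
columns: the rows of the last three pivots carry the free entries, and the remaining rows are
determined by them. The set `{4, 5, 6, 7}` has too few columns on its right for this, and
`exists_family_mid` treats it by also varying the plane. Adding up the sizes in `card_extraIndex`
gives a single bound for all `q`. -/

namespace ConstDimCode

/-! ### Gabidulin codes from linearized polynomials -/

section Gabidulin

variable {F : Type*} [Field F] [Finite F]

/-- The `F`-linear map `x ↦ ∑ i, f i * x ^ (q ^ i)` on an extension field `K` of the field `F`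
of order `q`. -/
noncomputable def linearizedPoly (F : Type*) [Field F] [Finite F] (K : Type*) [Field K]
    [Algebra F K] (k : ℕ) : (Fin k → K) →ₗ[F] K →ₗ[F] K :=
  letI := Fintype.ofFinite F
  ∑ i : Fin k, (LinearMap.mul F K).compl₁₂ (LinearMap.proj i)
    ((FiniteField.frobeniusAlgHom F K) ^ (i : ℕ)).toLinearMap

theorem linearizedPoly_apply {K : Type*} [Field K] [Algebra F K] {k : ℕ}
    (f : Fin k → K) (x : K) :
    linearizedPoly F K k f x = ∑ i, f i * x ^ (Nat.card F ^ (i : ℕ)) := by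
  let := Fintype.ofFinite F
  simp only [linearizedPoly, LinearMap.sum_apply, LinearMap.compl₁₂_apply, LinearMap.proj_apply,
    LinearMap.mul_apply', AlgHom.toLinearMap_apply]
  refine Finset.sum_congr rfl fun i _ => ?_
  rw [AlgHom.coe_pow, FiniteField.coe_frobeniusAlgHom, pow_iterate, Nat.card_eq_fintype_card]

/-- A nonzero linearized polynomial of `q`-degree less than `s` has a kernel of dimension less
than `s`. -/
theorem finrank_ker_linearizedPoly_lt {K : Type*} [Field K] [Algebra F K] [FiniteDimensional F K]
    {k : ℕ} {f : Fin k → K} (hf : f ≠ 0) {s : ℕ} (hs : ∀ i : Fin k, s ≤ i → f i = 0) :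
    Module.finrank F (LinearMap.ker (linearizedPoly F K k f)) < s := by
  classical
  have hK : Finite K := Module.finite_of_finite F
  have hq : 1 < Nat.card F := Finite.one_lt_card
  -- The kernel consists of roots of `p`, whose degree is at most `q^(s-1)`; comparing with `q^dim`
  -- bounds the dimension.
  let p : Polynomial K := ∑ i, Polynomial.C (f i) * Polynomial.X ^ (Nat.card F ^ (i : ℕ))
  have heval (x : K) : p.eval x = linearizedPoly F K k f x := by
    simp [p, Polynomial.eval_finsetSum, linearizedPoly_apply]
  have hcoeff (j : Fin k) : p.coeff (Nat.card F ^ (j : ℕ)) = f j := by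
    simp only [p, Polynomial.finsetSum_coeff, Polynomial.coeff_C_mul, Polynomial.coeff_X_pow]
    rw [Finset.sum_eq_single j]
    · simp
    · intro b _ hb
      rw [if_neg, mul_zero]
      intro h
      exact hb (Fin.ext (Nat.pow_right_injective hq h).symm)
    · simp
  obtain ⟨j, hj⟩ := Function.ne_iff.1 hf
  have hp : p ≠ 0 := by
    intro h
    apply hj
    rw [← hcoeff j, h]
    simp
  have hs0 : 0 < s := by
    by_contra h
    exact hj (hs j (by omega))
  have hdeg : p.natDegree ≤ Nat.card F ^ (s - 1) := by
    refine Polynomial.natDegree_sum_le_of_forall_le _ _ fun i _ => ?_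
    by_cases hi : s ≤ i
    · simp [hs i hi]
    · exact (Polynomial.natDegree_C_mul_X_pow_le _ _).trans
        (Nat.pow_le_pow_right hq.le (by omega))
  have hcard : Nat.card (LinearMap.ker (linearizedPoly F K k f)) ≤ p.natDegree := by
    have hsub : ((LinearMap.ker (linearizedPoly F K k f) : Submodule F K) : Set K)
        ⊆ p.roots.toFinset := by
      intro x hx
      simp only [Finset.mem_coe, Multiset.mem_toFinset, Polynomial.mem_roots hp,
        Polynomial.IsRoot.def, heval]
      exact hx
    calc Nat.card (LinearMap.ker (linearizedPoly F K k f))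
        = ((LinearMap.ker (linearizedPoly F K k f) : Submodule F K) : Set K).ncard := rfl
      _ ≤ (p.roots.toFinset : Set K).ncard := Set.ncard_le_ncard hsub
      _ = p.roots.toFinset.card := Set.ncard_coe_finset _
      _ ≤ p.roots.card := Multiset.toFinset_card_le _
      _ ≤ p.natDegree := Polynomial.card_roots' p
  have h1 := hcard.trans hdeg
  rw [Module.natCard_eq_pow_finrank (K := F), Nat.pow_le_pow_iff_right hq] at h1
  omega

/-- A Gabidulin code, as a linear family of linear maps `D → V` together with its nested
subcodes. -/
theorem exists_gabidulin (D V : Type*) [AddCommGroup D] [Module F D] [FiniteDimensional F D]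
    [AddCommGroup V] [Module F V] [FiniteDimensional F V] [Nontrivial V]
    (h : Module.finrank F D ≤ Module.finrank F V) (k : ℕ) :
    ∃ Φ : (Fin k → V) →ₗ[F] D →ₗ[F] V, ∀ g ≠ 0, ∀ s : ℕ, (∀ i : Fin k, s ≤ i → g i = 0) →
      Module.finrank F (LinearMap.ker (Φ g)) < s := by
  obtain ⟨p, hp⟩ := CharP.exists F
  have : Fact p.Prime := ⟨CharP.char_is_prime F p⟩
  have : NeZero (Module.finrank F V) := ⟨Module.finrank_pos.ne'⟩
  let K := FiniteField.Extension F p (Module.finrank F V)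
  have hK : Module.finrank F K = Module.finrank F V := FiniteField.finrank_extension F p _
  let e : V ≃ₗ[F] K := LinearEquiv.ofFinrankEq _ _ hK.symm
  obtain ⟨T, hT⟩ := (finrank_le_iff_exists_linearMap (R := F) (M := D) (M' := K)).1
    (h.trans_eq hK.symm)
  let E : (Fin k → V) →ₗ[F] (Fin k → K) := (LinearEquiv.piCongrRight fun _ => e).toLinearMap
  refine ⟨((linearizedPoly F K k).compl₁₂ E T).compr₂ e.symm.toLinearMap, ?_⟩
  intro g hg s hs
  have hE : E g ≠ 0 := fun h0 => hg ((LinearEquiv.piCongrRight fun _ : Fin k => e).injective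
    (h0.trans (map_zero _).symm))
  have hEs (i : Fin k) (hi : s ≤ i) : E g i = 0 := by
    simp [E, hs i hi]
  refine lt_of_le_of_lt ?_ (finrank_ker_linearizedPoly_lt (F := F) hE hEs)
  refine LinearMap.finrank_le_finrank_of_injective
    (f := (T.domRestrict _).codRestrict _ fun x => ?_) ?_
  · exact LinearMap.mem_ker.2
      (e.symm.injective ((LinearMap.mem_ker.1 x.2).trans (map_zero e.symm).symm))
  · intro x y hxy
    exact Subtype.ext (hT (congrArg Subtype.val hxy))

/-- A Gabidulin code in systematic form: the values on a `k`-dimensional subspace of `D` can be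
prescribed. -/
theorem exists_systematic_gabidulin (D V : Type*) [AddCommGroup D] [Module F D]
    [FiniteDimensional F D] [AddCommGroup V] [Module F V] [FiniteDimensional F V] [Nontrivial V]
    (h : Module.finrank F D ≤ Module.finrank F V) {k : ℕ} (c : Fin k → D)
    (hc : LinearIndependent F c) :
    ∃ Φ : (Fin k → V) →ₗ[F] D →ₗ[F] V, (∀ g i, Φ g (c i) = g i) ∧
      ∀ g ≠ 0, Module.finrank F (LinearMap.ker (Φ g)) < k := by
  obtain ⟨Φ, hΦ⟩ := exists_gabidulin D V h k
  have hker (g) (hg : g ≠ 0) := hΦ g hg k fun i hi => absurd i.2 (by omega)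
  -- `T` evaluates a codeword at the vectors `c i`. It is injective because a nonzero codeword
  -- cannot vanish on a `k`-dimensional space, so its inverse reparametrizes the code by these
  -- values.
  let T : (Fin k → V) →ₗ[F] (Fin k → V) := LinearMap.pi fun i => Φ.flip (c i)
  have hT : Function.Injective T := by
    rw [← LinearMap.ker_eq_bot, LinearMap.ker_eq_bot']
    intro g hg
    by_contra hg0
    refine (hker g hg0).not_ge ?_
    have hle : Submodule.span F (Set.range c) ≤ LinearMap.ker (Φ g) := by
      rw [Submodule.span_le]
      rintro _ ⟨i, rfl⟩
      exact congrFun hg i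
    simpa [finrank_span_eq_card hc] using Submodule.finrank_mono hle
  let e := LinearEquiv.ofInjectiveEndo T hT
  refine ⟨Φ ∘ₗ e.symm.toLinearMap, fun g i => ?_, fun g hg => hker _ (by simpa using hg)⟩
  have : T (e.symm g) = g := e.apply_symm_apply g
  exact congrFun this i

end Gabidulin
-- Intersections controlled by projections and leading positions
section Types

variable {F : Type*} [Field F] {P : Type*} [AddCommGroup P] [Module F P] {n : ℕ}

/-- `U ≤ P × F ^ n` has projection to `P` inside `X`, and the elements of `U` in `0 × F ^ n` have
their leading entries in positions from `v`. -/
def HasShape (U : Submodule F (P × (Fin n → F))) (X : Submodule F P) (v : Finset (Fin n)) : Prop :=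
  (∀ x ∈ U, x.1 ∈ X) ∧ ∀ w ≠ 0, ((0 : P), w) ∈ U → ∃ i ∈ v, w i ≠ 0 ∧ ∀ j < i, w j = 0

/-- Record the projection to `P` and the entries in `v ∩ v'`. A nonzero vector in the kernel of this
map would lie in `0 × F^n`, and its leading position would belong to both `v` and `v'`, where its
entry is zero. -/
theorem finrank_inf_le_of_hasShape [FiniteDimensional F P] {U U' : Submodule F (P × (Fin n → F))}
    {X X' : Submodule F P} {v v' : Finset (Fin n)} (h : HasShape U X v) (h' : HasShape U' X' v') :
    Module.finrank F ↥(U ⊓ U') ≤ Module.finrank F ↥(X ⊓ X') + (v ∩ v').card := by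
  let f : ↥(U ⊓ U') →ₗ[F] ↥(X ⊓ X') × (↥(v ∩ v') → F) :=
    (((LinearMap.fst F P (Fin n → F)).domRestrict (U ⊓ U')).codRestrict (X ⊓ X') fun x =>
      ⟨h.1 _ x.2.1, h'.1 _ x.2.2⟩).prod
      ((LinearMap.funLeft F F (fun i : ↥(v ∩ v') => (i : Fin n))) ∘ₗ
        (LinearMap.snd F P (Fin n → F)).domRestrict (U ⊓ U'))
  have hf : Function.Injective f := by
    rw [← LinearMap.ker_eq_bot, LinearMap.ker_eq_bot']
    rintro ⟨⟨a, w⟩, hx, hx'⟩ h0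
    have ha : a = 0 := congrArg (fun z => (z.1 : P)) h0
    have hw (i : Fin n) (hi : i ∈ v ∩ v') : w i = 0 := congrFun (congrArg Prod.snd h0) ⟨i, hi⟩
    subst ha
    by_cases hw0 : w = 0
    · subst hw0; rfl
    exfalso
    obtain ⟨i, hi, hwi, hlt⟩ := h.2 w hw0 hx
    obtain ⟨j, hj, hwj, hlt'⟩ := h'.2 w hw0 hx'
    obtain hij | rfl | hij := lt_trichotomy i j
    · exact hwi (hlt' i hij)
    · exact hwi (hw i (Finset.mem_inter.2 ⟨hi, hj⟩))
    · exact hwj (hlt j hij)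
  refine (LinearMap.finrank_le_finrank_of_injective hf).trans_eq ?_
  rw [Module.finrank_prod, Module.finrank_fintype_fun_eq_card, Fintype.card_coe]

end Types

/-! ### Codewords given by generating maps -/

section Codewords

variable {F : Type*} [Field F] {P : Type*} [AddCommGroup P] [Module F P] {n m k : ℕ}

/-- The vector with entry `y i` in position `p i`, and zeros elsewhere. -/
def spread {ι : Type*} [Fintype ι] (p : ι → Fin n) : (ι → F) →ₗ[F] (Fin n → F) :=
  LinearMap.pi fun j => ∑ i, if p i = j then LinearMap.proj i else 0

section Spread

variable {ι : Type*} [Fintype ι]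

theorem spread_apply (p : ι → Fin n) (y : ι → F) (j : Fin n) :
    spread p y j = ∑ i, if p i = j then y i else 0 := by
  simp only [spread, LinearMap.pi_apply, LinearMap.sum_apply]
  exact Finset.sum_congr rfl fun i _ => by split_ifs <;> simp

theorem spread_apply_self {p : ι → Fin n} (hp : Function.Injective p) (y : ι → F)
    (i : ι) : spread p y (p i) = y i := by
  rw [spread_apply, Finset.sum_eq_single i] <;> simp +contextual [hp.eq_iff]

theorem spread_apply_of_forall_ne {p : ι → Fin n} (y : ι → F) {j : Fin n} (h : ∀ i, p i ≠ j) :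
    spread p y j = 0 := by
  simp [spread_apply, h]

theorem spread_injective {p : ι → Fin n} (hp : Function.Injective p) :
    Function.Injective (spread (F := F) p) := fun y y' h => by
  funext i
  rw [← spread_apply_self hp y, h, spread_apply_self hp]

end Spread

/-- The generating map of a codeword: `x` generates the projection to `P`, `p` lists the pivot
positions in `F ^ n` and `A` gives the remaining entries. -/
def codewordMap (x : (Fin m → F) →ₗ[F] P) (p : Fin k → Fin n)
    (A : (Fin m → F) × (Fin k → F) →ₗ[F] (Fin n → F)) :
    (Fin m → F) × (Fin k → F) →ₗ[F] P × (Fin n → F) :=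
  (x ∘ₗ LinearMap.fst F _ _).prod (spread p ∘ₗ LinearMap.snd F _ _ + A)

theorem codewordMap_apply (x : (Fin m → F) →ₗ[F] P) (p : Fin k → Fin n)
    (A : (Fin m → F) × (Fin k → F) →ₗ[F] (Fin n → F)) (z) :
    codewordMap x p A z = (x z.1, spread p z.2 + A z) := rfl

/-- The nonpivot entries `A` vanish in the pivot positions. -/
def AvoidsPivots (p : Fin k → Fin n) (A : (Fin m → F) × (Fin k → F) →ₗ[F] (Fin n → F)) : Prop :=
  ∀ z i, A z (p i) = 0

/-- In the rows of the pivots, the entries `A` vanish to the left of the pivots. -/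
def IsEchelon (p : Fin k → Fin n) (A : (Fin m → F) × (Fin k → F) →ₗ[F] (Fin n → F)) : Prop :=
  ∀ i j, j < p i → A (0, Pi.single i 1) j = 0

variable {x x' : (Fin m → F) →ₗ[F] P} {p : Fin k → Fin n}
  {A A' : (Fin m → F) × (Fin k → F) →ₗ[F] (Fin n → F)}

theorem codewordMap_injective (hx : Function.Injective x) (hp : Function.Injective p)
    (hA : AvoidsPivots p A) : Function.Injective (codewordMap x p A) := by
  rw [← LinearMap.ker_eq_bot, LinearMap.ker_eq_bot']
  rintro ⟨u, y⟩ h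
  rw [codewordMap_apply] at h
  have hu : u = 0 := hx ((congrArg Prod.fst h).trans (map_zero x).symm)
  have hy : y = 0 := by
    funext i
    have := congrFun (congrArg Prod.snd h) (p i)
    simpa [spread_apply_self hp, hA (u, y) i] using this
  rw [hu, hy]
  rfl

theorem finrank_range_codewordMap (hx : Function.Injective x) (hp : Function.Injective p)
    (hA : AvoidsPivots p A) :
    Module.finrank F (LinearMap.range (codewordMap x p A)) = m + k := by
  rw [LinearMap.finrank_range_of_inj (codewordMap_injective hx hp hA)]
  simp

/-- Once the projection vanishes, only pivot rows contribute. By the echelon condition, the first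
row with nonzero coefficient puts the leading entry at its pivot, and no other row disturbs that
column. -/
theorem hasShape_codewordMap (hx : Function.Injective x) (hp : StrictMono p)
    (hA : AvoidsPivots p A) (hE : IsEchelon p A) :
    HasShape (LinearMap.range (codewordMap x p A)) (LinearMap.range x)
      (Finset.univ.image p) := by
  refine ⟨?_, ?_⟩
  · rintro _ ⟨z, rfl⟩
    exact ⟨z.1, rfl⟩
  · rintro w hw ⟨⟨u, y⟩, h⟩
    rw [codewordMap_apply] at h
    have hu : u = 0 := hx ((congrArg Prod.fst h).trans (map_zero x).symm)
    subst hu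
    have hwy (j) : w j = spread p y j + A (0, y) j := (congrFun (congrArg Prod.snd h) j).symm
    have hy : y ≠ 0 := by
      rintro rfl
      apply hw
      funext j
      have : A ((0 : Fin m → F), (0 : Fin k → F)) = 0 := map_zero A
      simp [hwy, this]
    classical
    have hne : (Finset.univ.filter fun i => y i ≠ 0).Nonempty := by
      obtain ⟨i, hi⟩ := Function.ne_iff.1 hy
      exact ⟨i, by simpa using hi⟩
    obtain ⟨i, hi, hmin⟩ := Finset.exists_minimal hne
    have hlt (l : Fin k) (hl : l < i) : y l = 0 := by
      by_contra h0
      exact hl.not_ge (hmin (by simpa using h0) hl.le)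
    refine ⟨p i, Finset.mem_image_of_mem _ (Finset.mem_univ _), ?_, fun j hj => ?_⟩
    · rw [hwy, spread_apply_self hp.injective, hA, add_zero]
      simpa using hi
    · have hAy : A (0, y) = ∑ l, y l • A (0, Pi.single l 1) := by
        have : ((0 : Fin m → F), y) = ∑ l, y l • ((0 : Fin m → F), (Pi.single l 1 : Fin k → F)) := by
          refine Prod.ext (by simp [Prod.fst_sum]) ?_
          simp only [Prod.snd_sum, Prod.smul_snd]
          funext j
          simp [Finset.sum_apply, Pi.single_apply]
        rw [this]
        simp only [map_sum, map_smul]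
      rw [hwy, spread_apply, hAy, Finset.sum_apply, ← Finset.sum_add_distrib]
      refine Finset.sum_eq_zero fun l _ => ?_
      obtain hl | hl := lt_or_ge l i
      · simp [hlt l hl]
      · have hjl : j < p l := hj.trans_le (hp.monotone hl)
        simp [hE l j hjl, hjl.ne']

/-- Two codewords with the same pivots and the same projection meet in the kernel of the difference
of their entries. -/
theorem finrank_inf_codewordMap_le_ker (hx : Function.Injective x) (hp : Function.Injective p)
    (hA : AvoidsPivots p A) (hA' : AvoidsPivots p A') :
    Module.finrank F
      ↥(LinearMap.range (codewordMap x p A) ⊓ LinearMap.range (codewordMap x p A')) ≤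
      Module.finrank F (LinearMap.ker (A - A')) := by
  have hle : LinearMap.range (codewordMap x p A) ⊓ LinearMap.range (codewordMap x p A') ≤
      (LinearMap.ker (A - A')).map (codewordMap x p A) := by
    rintro _ ⟨⟨⟨u, y⟩, rfl⟩, ⟨u', y'⟩, h⟩
    rw [codewordMap_apply, codewordMap_apply] at h
    have hu : u' = u := hx (congrArg Prod.fst h)
    -- The pivot columns show the coefficients directly, because both `A` and `A'` vanish there.
    have hy : y' = y := by
      funext i
      have := congrFun (congrArg Prod.snd h) (p i)
      simpa [spread_apply_self hp, hA (u, y) i, hA' (u', y') i] using this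
    subst hu hy
    refine ⟨(u', y'), ?_, rfl⟩
    have := add_left_cancel (congrArg Prod.snd h)
    simp [LinearMap.mem_ker, this]
  exact (Submodule.finrank_mono hle).trans (Submodule.finrank_map_le _ _)

/-- Two codewords with the same pivots and trivially intersecting projections meet in the kernel of
the difference of their entries in the pivot rows. -/
theorem finrank_inf_codewordMap_le_ker_inr (hx : Function.Injective x)
    (hx' : Function.Injective x') (hxx' : Disjoint (LinearMap.range x) (LinearMap.range x'))
    (hp : Function.Injective p) (hA : AvoidsPivots p A) (hA' : AvoidsPivots p A') :
    Module.finrank F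
      ↥(LinearMap.range (codewordMap x p A) ⊓ LinearMap.range (codewordMap x' p A')) ≤
      Module.finrank F (LinearMap.ker ((A - A') ∘ₗ LinearMap.inr F _ _)) := by
  have hle : LinearMap.range (codewordMap x p A) ⊓ LinearMap.range (codewordMap x' p A') ≤
      (LinearMap.ker ((A - A') ∘ₗ LinearMap.inr F _ _)).map
        (codewordMap x p A ∘ₗ LinearMap.inr F _ _) := by
    rintro _ ⟨⟨⟨u, y⟩, rfl⟩, ⟨u', y'⟩, h⟩
    rw [codewordMap_apply, codewordMap_apply] at h
    have h1 : x' u' = x u := congrArg Prod.fst h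
    have h0 : x u = 0 := Submodule.disjoint_def.1 hxx' _ ⟨u, rfl⟩ ⟨u', h1⟩
    have hu : u = 0 := hx (h0.trans (map_zero x).symm)
    have hu' : u' = 0 := hx' ((h1.trans h0).trans (map_zero x').symm)
    subst hu hu'
    have hy : y' = y := by
      funext i
      have := congrFun (congrArg Prod.snd h) (p i)
      simpa [spread_apply_self hp, hA (0, y) i, hA' (0, y') i] using this
    subst hy
    refine ⟨y', ?_, rfl⟩
    have := add_left_cancel (congrArg Prod.snd h)
    simp only [SetLike.mem_coe, LinearMap.mem_ker, LinearMap.comp_apply, LinearMap.sub_apply,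
      LinearMap.inr_apply]
    rw [sub_eq_zero]
    exact this.symm
  exact (Submodule.finrank_mono hle).trans (Submodule.finrank_map_le _ _)

end Codewords
-- Families of codewords and the partial spread
section Families

variable {F : Type*} [Field F] [Finite F] {P : Type*} [AddCommGroup P] [Module F P]

/-- The nonpivot positions to the right of the first pivot. -/
def freePositions {n k : ℕ} (p : Fin (k + 1) → Fin n) : Finset (Fin n) :=
  {j | p 0 < j ∧ ∀ i, p i ≠ j}

/-- The free entries of the rows of all pivots but the first one. -/
def freeEntries {n k : ℕ} (p : Fin (k + 1) → Fin n) : Finset (Fin k × Fin n) :=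
  {a | p a.1.succ < a.2 ∧ ∀ i, p i ≠ a.2}

/-- The family of codewords with given projection and given pivots obtained from a systematic
Gabidulin code. -/
theorem exists_family {n m k : ℕ} {x : (Fin m → F) →ₗ[F] P} (hx : Function.Injective x)
    {p : Fin (k + 1) → Fin n} (hp : StrictMono p) (hcard : m + (k + 1) ≤ (freePositions p).card) :
    ∃ U : (freeEntries p → F) → Submodule F (P × (Fin n → F)),
      (∀ c, Module.finrank F (U c) = m + (k + 1)) ∧
      (∀ c, HasShape (U c) (LinearMap.range x) (Finset.univ.image p)) ∧
      ∀ c c', c ≠ c' → Module.finrank F ↥(U c ⊓ U c') < k := by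
  have hne : Nonempty (freePositions p) := by
    rw [Finset.nonempty_coe_sort, ← Finset.card_pos]
    omega
  -- The systematic rows are those of all pivots but the first.
  have hlin : LinearIndependent F
      fun i : Fin k => ((0 : Fin m → F), (Pi.single i.succ 1 : Fin (k + 1) → F)) := by
    have h1 : LinearIndependent F fun i : Fin k => (Pi.single i.succ 1 : Fin (k + 1) → F) := by
      simpa only [Function.comp_def, Pi.basisFun_apply] using
        (Pi.basisFun F (Fin (k + 1))).linearIndependent.comp _ (Fin.succ_injective k)
    exact h1.map' (LinearMap.inr F (Fin m → F) (Fin (k + 1) → F)) (by simp)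
  obtain ⟨Φ, hΦ, hker⟩ := exists_systematic_gabidulin (F := F)
    ((Fin m → F) × (Fin (k + 1) → F)) (freePositions p → F) (by simpa using hcard) _ hlin
  let g (c : freeEntries p → F) (i : Fin k) (j : freePositions p) : F :=
    if h : (i, (j : Fin n)) ∈ freeEntries p then c ⟨_, h⟩ else 0
  have hg (c c') (h : c ≠ c') : g c - g c' ≠ 0 := by
    rw [sub_ne_zero]
    intro h'
    apply h
    funext ⟨⟨i, j⟩, hij⟩
    have hmem := (Finset.mem_filter.1 hij).2
    have hj : j ∈ freePositions p := Finset.mem_filter.2 ⟨Finset.mem_univ _,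
      (hp.monotone (Fin.zero_le _)).trans_lt hmem.1, hmem.2⟩
    have := congrFun (congrFun h' i) ⟨j, hj⟩
    simpa [g, hij] using this
  let A (c : freeEntries p → F) := spread (Subtype.val : freePositions p → Fin n) ∘ₗ Φ (g c)
  have hA (c) : AvoidsPivots p (A c) := fun z i =>
    spread_apply_of_forall_ne _ fun j h => (Finset.mem_filter.1 j.2).2.2 i h.symm
  have hE (c) : IsEchelon p (A c) := by
    intro i j hj
    by_cases hjN : j ∈ freePositions p
    · have h1 : A c (0, Pi.single i 1) j = Φ (g c) (0, Pi.single i 1) ⟨j, hjN⟩ :=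
        spread_apply_self Subtype.val_injective _ (⟨j, hjN⟩ : freePositions p)
      rw [h1]
      have hj0 := (Finset.mem_filter.1 hjN).2.1
      cases i using Fin.cases with
      -- All free positions lie to the right of the first pivot, so its row may be filled
      -- arbitrarily by the Gabidulin code.
      | zero => exact absurd hj hj0.not_gt
      | succ i =>
        rw [hΦ]
        refine dif_neg fun h => ?_
        exact (Finset.mem_filter.1 h).2.1.not_gt hj
    · exact spread_apply_of_forall_ne _ fun i h => hjN (h ▸ i.2)
  refine ⟨fun c => LinearMap.range (codewordMap x p (A c)),
    fun c => finrank_range_codewordMap hx hp.injective (hA c),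
    fun c => hasShape_codewordMap hx hp (hA c) (hE c), fun c c' h => ?_⟩
  refine (finrank_inf_codewordMap_le_ker hx hp.injective (hA c) (hA c')).trans_lt ?_
  have : A c - A c' = spread (Subtype.val : freePositions p → Fin n) ∘ₗ Φ (g c - g c') := by
    simp only [A, map_sub, LinearMap.comp_sub]
  rw [this, LinearMap.ker_comp_of_ker_eq_bot _
    (LinearMap.ker_eq_bot.2 (spread_injective Subtype.val_injective))]
  exact hker _ (hg c c' h)

/-- A linear family of `q ^ r` linear maps from `F ^ m` to `F ^ r`, the nonzero ones of which are
injective. -/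
theorem exists_injective_family {m r : ℕ} (hr : 0 < r) (h : m ≤ r) :
    ∃ M : (Fin r → F) →ₗ[F] (Fin m → F) →ₗ[F] (Fin r → F), ∀ e ≠ 0, Function.Injective (M e) := by
  have : Nonempty (Fin r) := ⟨⟨0, hr⟩⟩
  obtain ⟨Φ, hΦ⟩ := exists_gabidulin (F := F) (Fin m → F) (Fin r → F) (by simpa using h) 1
  refine ⟨Φ ∘ₗ LinearMap.pi fun _ => LinearMap.id, fun e he => ?_⟩
  have h1 := hΦ (fun _ => e) (fun h => he (congrFun h 0)) 1 fun i hi => absurd i.2 (by omega)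
  rw [← LinearMap.ker_eq_bot, ← Submodule.finrank_eq_zero (R := F)]
  exact Nat.lt_one_iff.1 h1

/-- A partial spread of `m`-dimensional subspaces. -/
theorem exists_partial_spread {m r d : ℕ} (hr : 0 < r) (h : m ≤ r) (hd : m + r = d)
    {ι : Type*} [Finite ι] (hι : Nat.card ι ≤ Nat.card F ^ r) :
    ∃ x : ι → (Fin m → F) →ₗ[F] (Fin d → F), (∀ i, Function.Injective (x i)) ∧
      ∀ i j, i ≠ j → Disjoint (LinearMap.range (x i)) (LinearMap.range (x j)) := by
  obtain ⟨M, hM⟩ := exists_injective_family (F := F) hr h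
  let := Fintype.ofFinite F
  let := Fintype.ofFinite ι
  obtain ⟨s⟩ := Function.Embedding.nonempty_of_card_le (α := ι) (β := Fin r → F)
    (by simpa using hι)
  let E : ((Fin m → F) × (Fin r → F)) ≃ₗ[F] (Fin d → F) :=
    LinearEquiv.ofFinrankEq _ _ (by simpa using hd)
  -- The members are graphs of maps `M (s i)`; they are disjoint because differences of distinct
  -- maps are injective.
  refine ⟨fun i => E.toLinearMap ∘ₗ LinearMap.id.prod (M (s i)), fun i u u' h => ?_,
    fun i j hij => ?_⟩
  · exact congrArg Prod.fst (E.injective h)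
  · rw [Submodule.disjoint_def]
    rintro _ ⟨u, rfl⟩ ⟨u', h⟩
    have h := E.injective h
    have hu : u' = u := congrArg Prod.fst h
    subst hu
    have h2 : M (s j) u' = M (s i) u' := congrArg Prod.snd h
    have h3 : M (s i - s j) u' = 0 := by simp [h2]
    have hu0 : u' = 0 := hM _ (sub_ne_zero.2 (s.injective.ne hij)) (h3.trans (map_zero _).symm)
    simp [hu0]

/-- A family with pivots in the positions `4, 5, 6, 7` of `F ^ 13`, whose projections vary among
`q` subspaces. -/
theorem exists_family_mid {x : F → (Fin 2 → F) →ₗ[F] P} (hx : ∀ t, Function.Injective (x t))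
    (hxx : ∀ t t', t ≠ t' → Disjoint (LinearMap.range (x t)) (LinearMap.range (x t'))) :
    ∃ U : (Fin 3 → Fin 5 → F) → Submodule F (P × (Fin 13 → F)),
      (∀ g, Module.finrank F (U g) = 6) ∧
      (∀ g, ∃ t, HasShape (U g) (LinearMap.range (x t)) {4, 5, 6, 7}) ∧
      ∀ g g', g ≠ g' → Module.finrank F ↥(U g ⊓ U g') ≤ 2 := by
  -- Only five columns lie to the right of the pivots, but there are six rows. The Gabidulin code
  -- `Φ` therefore ignores one projection row, and the loss is made up by the top coefficient `g 2`:
  -- its first entry chooses the plane, and its other four choose an injective or zero map `M` into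
  -- the columns left of the pivots.
  obtain ⟨M, hM⟩ := exists_injective_family (F := F) (m := 2) (r := 4) (by norm_num) (by norm_num)
  obtain ⟨Φ, hΦ⟩ := exists_gabidulin (F := F) (F × (Fin 4 → F)) (Fin 5 → F) (by simp) 3
  let p : Fin 4 → Fin 13 := ![4, 5, 6, 7]
  let pl : Fin 4 → Fin 13 := ![0, 1, 2, 3]
  let pr : Fin 5 → Fin 13 := ![8, 9, 10, 11, 12]
  have hp : StrictMono p := by decide
  have hpl : Function.Injective pl := by decide
  have hpr : Function.Injective pr := by decide
  let T : (Fin 2 → F) × (Fin 4 → F) →ₗ[F] F × (Fin 4 → F) :=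
    (LinearMap.proj 1).prodMap LinearMap.id
  let tail : (Fin 3 → Fin 5 → F) →ₗ[F] (Fin 4 → F) :=
    LinearMap.funLeft F F Fin.succ ∘ₗ LinearMap.proj 2
  let A : (Fin 3 → Fin 5 → F) →ₗ[F] (Fin 2 → F) × (Fin 4 → F) →ₗ[F] (Fin 13 → F) :=
    (Φ.compr₂ (spread pr)).compl₂ T +
      ((M ∘ₗ tail).compr₂ (spread pl)).compl₂ (LinearMap.fst F _ _)
  have hAapp (g z) : A g z = spread pr (Φ g (T z)) + spread pl (M (tail g) z.1) := rfl
  have hker (g z) (h : A g z = 0) : Φ g (T z) = 0 ∧ M (tail g) z.1 = 0 := by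
    rw [hAapp] at h
    constructor
    · funext i
      have := congrFun h (pr i)
      have hne : ∀ i l, pl l ≠ pr i := by decide
      rwa [Pi.add_apply, spread_apply_self hpr,
        spread_apply_of_forall_ne _ (hne i), add_zero] at this
    · funext i
      have := congrFun h (pl i)
      have hne : ∀ i l, pr l ≠ pl i := by decide
      rwa [Pi.add_apply, spread_apply_self hpl,
        spread_apply_of_forall_ne _ (hne i), zero_add] at this
  have hA (g) : AvoidsPivots p (A g) := by
    intro z i
    have hne : ∀ i l, pl l ≠ p i := by decide
    have hne' : ∀ i l, pr l ≠ p i := by decide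
    rw [hAapp, Pi.add_apply, spread_apply_of_forall_ne _ (hne i),
      spread_apply_of_forall_ne _ (hne' i), add_zero]
  have hE (g) : IsEchelon p (A g) := by
    intro i j hj
    have hne : ∀ i j, j < p i → ∀ l, pr l ≠ j := by decide
    rw [hAapp, map_zero, map_zero, add_zero, spread_apply_of_forall_ne _ (hne i j hj)]
  refine ⟨fun g => LinearMap.range (codewordMap (x (g 2 0)) p (A g)),
    fun g => finrank_range_codewordMap (hx _) hp.injective (hA g),
    fun g => ⟨g 2 0, hasShape_codewordMap (hx _) hp (hA g) (hE g)⟩, fun g g' hgg' => ?_⟩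
  have hh : g - g' ≠ 0 := sub_ne_zero.2 hgg'
  have hker2 : Module.finrank F (LinearMap.ker (Φ (g - g'))) ≤ 2 :=
    Nat.lt_succ_iff.1 (hΦ _ hh 3 fun i hi => absurd i.2 (by omega))
  by_cases ht : g 2 0 = g' 2 0
  · change Module.finrank F ↥(LinearMap.range (codewordMap (x (g 2 0)) p (A g)) ⊓
      LinearMap.range (codewordMap (x (g' 2 0)) p (A g'))) ≤ 2
    rw [← ht]
    refine (finrank_inf_codewordMap_le_ker (hx _) hp.injective (hA g) (hA g')).trans ?_
    rw [← map_sub]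
    -- With equal planes and equal tails, the top coefficient of `g - g'` vanishes. The kernel of `Φ
    -- (g - g')` then has dimension at most 1, and the ignored coordinate adds at most 1.
    by_cases he : tail (g - g') = 0
    · have h2 : (g - g') 2 = 0 := by
        funext i
        cases i using Fin.cases with
        | zero => simpa [sub_eq_zero] using ht
        | succ i => exact congrFun he i
      have hker1 : Module.finrank F (LinearMap.ker (Φ (g - g'))) < 2 := by
        refine hΦ _ hh 2 fun i hi => ?_
        have : i = 2 := by omega
        rw [this, h2]
      let f : LinearMap.ker (A (g - g')) →ₗ[F] F × LinearMap.ker (Φ (g - g')) :=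
        ((LinearMap.proj 0 ∘ₗ LinearMap.fst F _ _).domRestrict _).prod
          ((T.domRestrict _).codRestrict _ fun z => (hker _ _ z.2).1)
      have hf : Function.Injective f := by
        rintro ⟨⟨u, y⟩, h⟩ ⟨⟨u', y'⟩, h'⟩ hff
        have h0 : u 0 = u' 0 := congrArg Prod.fst hff
        have hT : (u 1, y) = (u' 1, y') := congrArg (fun z => (z.2 : F × (Fin 4 → F))) hff
        have hu : u = u' := by
          funext i
          fin_cases i
          · exact h0
          · exact congrArg Prod.fst hT
        have hy : y = y' := congrArg Prod.snd hT
        subst hu hy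
        rfl
      have := LinearMap.finrank_le_finrank_of_injective hf
      rw [Module.finrank_prod, Module.finrank_self] at this
      omega
    -- Here `M` forces the projection part `u` to vanish, so the ignored coordinate adds nothing.
    · refine le_trans ?_ hker2
      refine LinearMap.finrank_le_finrank_of_injective
        (f := (T.domRestrict _).codRestrict _ fun z => (hker _ _ z.2).1) ?_
      rintro ⟨⟨u, y⟩, h⟩ ⟨⟨u', y'⟩, h'⟩ hff
      have hT : (u 1, y) = (u' 1, y') := congrArg Subtype.val hff
      have hu : u = 0 := hM _ he ((hker _ _ h).2.trans (map_zero _).symm)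
      have hu' : u' = 0 := hM _ he ((hker _ _ h').2.trans (map_zero _).symm)
      have hy : y = y' := congrArg Prod.snd hT
      subst hu hu' hy
      rfl
  -- Disjoint planes leave only the pivot rows, and `T` is injective on them.
  · refine (finrank_inf_codewordMap_le_ker_inr (hx _) (hx _) (hxx _ _ ht) hp.injective (hA g)
      (hA g')).trans ?_
    rw [← map_sub]
    refine le_trans ?_ hker2
    refine LinearMap.finrank_le_finrank_of_injective
      (f := ((T ∘ₗ LinearMap.inr F _ _).domRestrict _).codRestrict _
        fun y => (hker _ _ y.2).1) ?_
    rintro ⟨y, h⟩ ⟨y', h'⟩ hff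
    exact Subtype.ext (congrArg Prod.snd (congrArg Subtype.val hff))

end Families
-- The lifted MRD code as a family of graphs
section Lifted

variable {F : Type*} [Field F]

/-- The splitting of the coordinates of `F ^ (k + m)` into the first `k` and the last `m`. -/
def coordSplit (F : Type*) [Field F] (k m : ℕ) :
    ((Fin k → F) × (Fin m → F)) ≃ₗ[F] (Fin (k + m) → F) :=
  (LinearEquiv.sumArrowLequivProdArrow (Fin k) (Fin m) F F).symm ≪≫ₗ
    LinearEquiv.funCongrLeft F F finSumFinEquiv.symm

theorem coordSplit_castAdd {k m : ℕ} (z : (Fin k → F) × (Fin m → F)) (i : Fin k) :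
    coordSplit F k m z (Fin.castAdd m i) = z.1 i := by
  simp only [coordSplit, LinearEquiv.trans_apply, LinearEquiv.funCongrLeft_apply,
    LinearMap.funLeft_apply, finSumFinEquiv_symm_apply_castAdd]
  rfl

theorem coordSplit_natAdd {k m : ℕ} (z : (Fin k → F) × (Fin m → F)) (i : Fin m) :
    coordSplit F k m z (Fin.natAdd k i) = z.2 i := by
  simp only [coordSplit, LinearEquiv.trans_apply, LinearEquiv.funCongrLeft_apply,
    LinearMap.funLeft_apply, finSumFinEquiv_symm_apply_natAdd]
  rfl

/-- The graph of `L`, for the codeword that lifts the matrix of `L`. -/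
def graphOf {k m : ℕ} (L : (Fin k → F) →ₗ[F] (Fin m → F)) :
    Submodule F ((Fin k → F) × (Fin m → F)) :=
  LinearMap.range (LinearMap.id.prod L)

/-- The matrix whose rows are the images of the unit vectors under `L`. -/
def rowMatrix (F : Type*) [Field F] (k m : ℕ) :
    ((Fin k → F) →ₗ[F] (Fin m → F)) ≃ₗ[F] Matrix (Fin k) (Fin m) F :=
  LinearMap.toMatrix' ≪≫ₗ Matrix.transposeLinearEquiv (Fin m) (Fin k) F F

theorem rowMatrix_apply {k m : ℕ} (L : (Fin k → F) →ₗ[F] (Fin m → F)) (i : Fin k) (j : Fin m) :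
    rowMatrix F k m L i j = L (Pi.single i 1) j := by
  simp [rowMatrix, LinearMap.toMatrix'_apply]

theorem rank_rowMatrix {k m : ℕ} (L : (Fin k → F) →ₗ[F] (Fin m → F)) :
    (rowMatrix F k m L).rank + Module.finrank F (LinearMap.ker L) = k := by
  have h : (rowMatrix F k m L).rank = Module.finrank F (LinearMap.range L) := by
    change (LinearMap.toMatrix' L).transpose.rank = _
    rw [Matrix.rank_transpose, Matrix.rank, ← Matrix.toLin'_apply', Matrix.toLin'_toMatrix']
  rw [h, LinearMap.finrank_range_add_finrank_ker]
  simp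

theorem lift_rowMatrix (L : (Fin 6 → F) →ₗ[F] (Fin 13 → F)) :
    lift (n := 19) (k := 6) (rowMatrix F 6 13 L) =
      (graphOf L).map (coordSplit F 6 13).toLinearMap := by
  rw [lift, ← _root_.range_vecMulLinear, graphOf, ← LinearMap.range_comp]
  congr 1
  refine (Pi.basisFun F (Fin 6)).ext fun i => ?_
  rw [Pi.basisFun_apply, Matrix.vecMulLinear_apply, Matrix.single_one_vecMul]
  funext j
  change liftMatrix (rowMatrix F 6 13 L) i j =
    coordSplit F 6 13 (Pi.single i 1, L (Pi.single i 1)) j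
  refine Fin.addCases (m := 6) (n := 13) (fun j => ?_) (fun j => ?_) j
  · rw [coordSplit_castAdd]
    simp [liftMatrix, Pi.single_apply, Fin.ext_iff]
  · rw [coordSplit_natAdd]
    refine Eq.trans ?_ (rowMatrix_apply L i j)
    simp [liftMatrix]

theorem finrank_graphOf {k m : ℕ} (L : (Fin k → F) →ₗ[F] (Fin m → F)) :
    Module.finrank F (graphOf L) = k := by
  rw [graphOf, LinearMap.finrank_range_of_inj]
  · simp
  · exact fun u u' h => congrArg Prod.fst h

theorem hasShape_graphOf {k m : ℕ} (L : (Fin k → F) →ₗ[F] (Fin m → F)) :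
    HasShape (graphOf L) ⊤ ∅ := by
  refine ⟨fun _ _ => trivial, ?_⟩
  rintro w hw ⟨u, h⟩
  have hu : u = 0 := congrArg Prod.fst h
  refine absurd ?_ hw
  have hw' : L u = w := congrArg Prod.snd h
  rw [← hw', hu, map_zero]

theorem finrank_graphOf_inf_graphOf {k m : ℕ} (L L' : (Fin k → F) →ₗ[F] (Fin m → F)) :
    Module.finrank F ↥(graphOf L ⊓ graphOf L') = Module.finrank F (LinearMap.ker (L - L')) := by
  have : graphOf L ⊓ graphOf L' = (LinearMap.ker (L - L')).map (LinearMap.id.prod L) := by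
    ext z
    constructor
    · rintro ⟨⟨u, rfl⟩, u', h⟩
      have hu : u' = u := congrArg Prod.fst h
      subst hu
      have h2 : L' u' = L u' := congrArg Prod.snd h
      exact ⟨u', by simp [h2], rfl⟩
    · rintro ⟨u, hu, rfl⟩
      exact ⟨⟨u, rfl⟩, u, Prod.ext rfl (sub_eq_zero.1 (LinearMap.mem_ker.1 hu)).symm⟩
  rw [this]
  exact (Submodule.equivMapOfInjective (LinearMap.id.prod L)
    (fun u u' h => congrArg Prod.fst h) _).finrank_eq.symm

/-- A lifted MRD code in `F ^ 19`, as a family of graphs. -/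
theorem exists_lifted [Finite F] :
    ∃ L : (Fin 3 → Fin 13 → F) → (Fin 6 → F) →ₗ[F] (Fin 13 → F),
      (∀ g g', g ≠ g' → Module.finrank F ↥(graphOf (L g) ⊓ graphOf (L g')) ≤ 2) ∧
      (∃ g g', g ≠ g' ∧ Module.finrank F ↥(graphOf (L g) ⊓ graphOf (L g')) = 2) ∧
      IsLiftedMRD F 19 4 6
        (Set.range fun g => (graphOf (L g)).map (coordSplit F 6 13).toLinearMap) := by
  let c (i : Fin 3) : Fin 6 → F := Pi.single (Fin.castLE (by norm_num) i) 1
  have hc : LinearIndependent F c := by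
    simpa only [Function.comp_def, Pi.basisFun_apply] using
      (Pi.basisFun F (Fin 6)).linearIndependent.comp (Fin.castLE (by norm_num : 3 ≤ 6))
        (Fin.castLE_injective _)
  obtain ⟨Φ, hΦ, hker⟩ := exists_systematic_gabidulin (F := F) (Fin 6 → F) (Fin 13 → F)
    (by simp) c hc
  have hle (g g') (h : g ≠ g') :
      Module.finrank F ↥(graphOf (Φ g) ⊓ graphOf (Φ g')) ≤ 2 := by
    rw [finrank_graphOf_inf_graphOf, ← map_sub]
    exact Nat.lt_succ_iff.1 (hker _ (sub_ne_zero.2 h))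
  have hinj : Function.Injective Φ := by
    rw [← LinearMap.ker_eq_bot, LinearMap.ker_eq_bot']
    intro g hg
    funext i
    rw [← hΦ g i, hg]
    rfl
  let R : (Fin 3 → Fin 13 → F) →ₗ[F] Matrix (Fin 6) (Fin 13) F :=
    (rowMatrix F 6 13).toLinearMap ∘ₗ Φ
  have hR : Function.Injective R := (rowMatrix F 6 13).injective.comp hinj
  refine ⟨Φ, hle, ?_, by norm_num, LinearMap.range R, ⟨by norm_num, by norm_num, ?_, ?_⟩, ?_⟩
  · let g : Fin 3 → Fin 13 → F := Pi.single 2 (Pi.single 0 1)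
    have hg : g ≠ 0 := by simp [g]
    refine ⟨g, 0, hg, le_antisymm (hle _ _ hg) ?_⟩
    rw [finrank_graphOf_inf_graphOf, map_zero, sub_zero]
    have hlin : LinearIndependent F (c ∘ Fin.castLE (by norm_num : 2 ≤ 3)) :=
      hc.comp _ (Fin.castLE_injective _)
    have hsub : Submodule.span F (Set.range (c ∘ Fin.castLE (by norm_num : 2 ≤ 3))) ≤
        LinearMap.ker (Φ g) := by
      rw [Submodule.span_le]
      rintro _ ⟨i, rfl⟩
      change Φ g (c _) = 0
      rw [hΦ]
      fin_cases i <;> simp [g]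
    simpa [finrank_span_eq_card hlin] using Submodule.finrank_mono hsub
  · rintro _ ⟨g, rfl⟩ _ ⟨g', rfl⟩ h
    have hne : g - g' ≠ 0 := sub_ne_zero.2 fun h' => h (h' ▸ rfl)
    have h1 := rank_rowMatrix (Φ (g - g'))
    have h2 := hker _ hne
    change 4 ≤ (R g - R g').rank
    rw [← map_sub]
    change 4 ≤ (rowMatrix F 6 13 (Φ (g - g'))).rank
    omega
  · rw [← Nat.card_congr (LinearEquiv.ofInjective R hR).toEquiv, Nat.card_fun, Nat.card_fun,
      ← pow_mul]
    simp
  · ext U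
    constructor
    · rintro ⟨g, rfl⟩
      exact ⟨R g, ⟨g, rfl⟩, (lift_rowMatrix _).symm⟩
    · rintro ⟨_, ⟨g, rfl⟩, rfl⟩
      exact ⟨g, (lift_rowMatrix _).symm⟩

end Lifted
-- Pivot sets and their combinatorics
section Skeleton

/-- Pivot positions in `F ^ 13`: all blocks of the affine space `AG(3, 2)` on `0, …, 7` except
`{4, 5, 6, 7}`, and five more sets that meet these blocks and each other in at most two points. -/
def pivots : Fin 18 → Fin 4 → Fin 13 :=
  ![![0, 1, 2, 3], ![0, 1, 4, 5], ![2, 3, 6, 7], ![0, 1, 6, 7], ![2, 3, 4, 5], ![0, 2, 4, 6],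
    ![1, 3, 5, 7], ![0, 2, 5, 7], ![1, 3, 4, 6], ![0, 3, 4, 7], ![1, 2, 5, 6], ![0, 3, 5, 6],
    ![1, 2, 4, 7], ![0, 1, 8, 9], ![2, 3, 8, 9], ![0, 2, 8, 10], ![1, 3, 8, 10], ![1, 2, 8, 11]]

/-- Labels of the pivot sets, which agree only for disjoint sets. -/
def labels : Fin 18 → Fin 12 := ![0, 1, 1, 2, 2, 3, 3, 4, 4, 5, 5, 6, 6, 7, 8, 9, 10, 11]

theorem strictMono_pivots (k : Fin 18) : StrictMono (pivots k) := by
  revert k; decide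

/-- The Gabidulin code of `exists_family` needs at least as many columns as its `2 + 4` rows. -/
theorem six_le_card_freePositions (k : Fin 18) : 6 ≤ (freePositions (pivots k)).card := by
  revert k; decide

theorem card_freeEntries (k : Fin 18) : (freeEntries (pivots k)).card =
    ![27, 23, 17, 19, 21, 21, 18, 19, 20, 19, 20, 19, 20, 15, 13, 13, 12, 12] k := by
  revert k; decide

/-- A label selects a plane of the spread. Complementary blocks of `AG(3, 2)` may share a plane
because they have no common position, so 12 planes serve 18 pivot sets. -/
theorem pivots_inter (k l : Fin 18) (h : k ≠ l) :
    (labels k ≠ labels l ∧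
      (Finset.univ.image (pivots k) ∩ Finset.univ.image (pivots l)).card ≤ 2) ∨
      (Finset.univ.image (pivots k) ∩ Finset.univ.image (pivots l)).card = 0 := by
  revert k l; decide

theorem pivots_inter_mid (k : Fin 18) :
    (Finset.univ.image (pivots k) ∩ {4, 5, 6, 7}).card ≤ 2 := by
  revert k; decide

/-- The index set of the codewords other than those of the lifted MRD code. -/
abbrev ExtraIndex (F : Type*) : Type _ :=
  (Σ k : Fin 18, freeEntries (pivots k) → F) ⊕ (Fin 3 → Fin 5 → F)

theorem card_extraIndex (F : Type*) [Finite F] : Nat.card (ExtraIndex F) =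
    (Nat.card F) ^ 27 + (Nat.card F) ^ 23 + 2 * (Nat.card F) ^ 21 + 3 * (Nat.card F) ^ 20
      + 4 * (Nat.card F) ^ 19 + (Nat.card F) ^ 18 + (Nat.card F) ^ 17 + 2 * (Nat.card F) ^ 15
      + 2 * (Nat.card F) ^ 13 + 2 * (Nat.card F) ^ 12 := by
  have h (k : Fin 18) : Nat.card (freeEntries (pivots k) → F) = (Nat.card F) ^
      (![27, 23, 17, 19, 21, 21, 18, 19, 20, 19, 20, 19, 20, 15, 13, 13, 12, 12] k) := by
    rw [Nat.card_fun, Nat.card_eq_fintype_card (α := freeEntries (pivots k)), Fintype.card_coe,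
      card_freeEntries]
  rw [Nat.card_sum, Nat.card_sigma]
  simp only [h, Fin.sum_univ_succ, Nat.card_fun, Nat.card_eq_fintype_card (α := Fin _),
    Fintype.card_fin, ← pow_mul]
  simp
  ring

end Skeleton

/-! ### Joining the families into one code -/

section Assembly

variable {F : Type*} [Field F]

/-- Families with small pairwise intersections can be joined. -/
theorem finrank_inf_sumElim_le {E : Type*} [AddCommGroup E] [Module F E] {I J : Type*} {d : ℕ}
    {U : I → Submodule F E} {V : J → Submodule F E}
    (hU : ∀ i j, i ≠ j → Module.finrank F ↥(U i ⊓ U j) ≤ d)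
    (hV : ∀ i j, i ≠ j → Module.finrank F ↥(V i ⊓ V j) ≤ d)
    (hUV : ∀ i j, Module.finrank F ↥(U i ⊓ V j) ≤ d) (i j : I ⊕ J) (h : i ≠ j) :
    Module.finrank F ↥(Sum.elim U V i ⊓ Sum.elim U V j) ≤ d := by
  rcases i with i | i <;> rcases j with j | j
  · exact hU i j fun h' => h (h' ▸ rfl)
  · exact hUV i j
  · rw [inf_comm]
    exact hUV j i
  · exact hV i j fun h' => h (h' ▸ rfl)

theorem finrank_inf_le_two_of_hasShape {n : ℕ} {P : Type*} [AddCommGroup P] [Module F P]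
    [FiniteDimensional F P] {U U' : Submodule F (P × (Fin n → F))}
    {x x' : (Fin 2 → F) →ₗ[F] P} {v v' : Finset (Fin n)} (h : HasShape U (LinearMap.range x) v)
    (h' : HasShape U' (LinearMap.range x') v')
    (hxv : (Disjoint (LinearMap.range x) (LinearMap.range x') ∧ (v ∩ v').card ≤ 2) ∨
      (v ∩ v').card = 0) :
    Module.finrank F ↥(U ⊓ U') ≤ 2 := by
  refine (finrank_inf_le_of_hasShape h h').trans ?_
  obtain ⟨hd, hv⟩ | hv := hxv
  · rw [hd.eq_bot, finrank_bot]
    omega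
  · rw [hv, add_zero]
    refine (Submodule.finrank_mono inf_le_left).trans ((LinearMap.finrank_range_le x).trans ?_)
    simp

/-- The codewords other than those of the lifted MRD code. -/
theorem exists_extra [Finite F] :
    ∃ U : ExtraIndex F → Submodule F ((Fin 6 → F) × (Fin 13 → F)),
      (∀ i, Module.finrank F (U i) = 6) ∧
      (∀ i j, i ≠ j → Module.finrank F ↥(U i ⊓ U j) ≤ 2) ∧
      ∀ i, ∃ (x : (Fin 2 → F) →ₗ[F] (Fin 6 → F)) (v : Finset (Fin 13)),
        HasShape (U i) (LinearMap.range x) v := by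
  have hq : 1 < Nat.card F := Finite.one_lt_card
  -- Twelve planes are used for the labels and `q` more for the set `{4, 5, 6, 7}`; there is room
  -- since `12 + q ≤ q^4` already at `q = 2`.
  obtain ⟨x, hx, hxx⟩ := exists_partial_spread (F := F) (m := 2) (r := 4) (d := 6)
    (by norm_num) (by norm_num) (by norm_num) (ι := Fin 12 ⊕ F) (by
      rw [Nat.card_sum, Nat.card_eq_fintype_card (α := Fin 12), Fintype.card_fin]
      nlinarith [Nat.pow_le_pow_left hq 3])
  choose U hU6 hUs hU2 using fun k => exists_family (hx (Sum.inl (labels k)))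
    (strictMono_pivots k) (six_le_card_freePositions k)
  obtain ⟨V, hV6, hVs, hV2⟩ := exists_family_mid (fun t => hx (Sum.inr t)) fun t t' h =>
    hxx _ _ fun h' => h (Sum.inr_injective h')
  refine ⟨Sum.elim (fun a => U a.1 a.2) V, ?_, finrank_inf_sumElim_le ?_ hV2 ?_, ?_⟩
  · rintro (a | g)
    · exact hU6 a.1 a.2
    · exact hV6 g
  · rintro ⟨k, c⟩ ⟨l, c'⟩ h
    by_cases hkl : k = l
    · subst hkl
      exact Nat.lt_succ_iff.1 (hU2 k c c' fun h' => h (h' ▸ rfl))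
    · exact finrank_inf_le_two_of_hasShape (hUs k c) (hUs l c') ((pivots_inter k l hkl).imp_left
        fun h1 => ⟨hxx _ _ fun h' => h1.1 (Sum.inl_injective h'), h1.2⟩)
  · rintro ⟨k, c⟩ g
    obtain ⟨t, ht⟩ := hVs g
    exact finrank_inf_le_two_of_hasShape (hUs k c) ht
      (Or.inl ⟨hxx _ _ Sum.inl_ne_inr, pivots_inter_mid k⟩)
  · rintro (a | g)
    · exact ⟨_, _, hUs a.1 a.2⟩
    · obtain ⟨t, ht⟩ := hVs g
      exact ⟨_, _, ht⟩

/-- A family of `k`-dimensional subspaces with pairwise intersections of dimension at most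
`k - δ` is a constant dimension code of distance `2 * δ` if that dimension is attained. -/
theorem isCDC_range {n k δ : ℕ} (hδ : 0 < δ) (hδk : δ ≤ k) {I : Type*}
    {U : I → Submodule F (Fin n → F)} (hU : ∀ i, Module.finrank F (U i) = k)
    (h : ∀ i j, i ≠ j → Module.finrank F ↥(U i ⊓ U j) ≤ k - δ)
    (he : ∃ i j, i ≠ j ∧ Module.finrank F ↥(U i ⊓ U j) = k - δ) :
    IsCDC F n (Nat.card I) (2 * δ) k (Set.range U) := by
  have hinj : Function.Injective U := by
    intro i j hij
    by_contra hne
    have := h i j hne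
    rw [hij, inf_idem, hU] at this
    omega
  refine ⟨Set.ncard_range_of_injective hinj, ?_, ?_, ?_⟩
  · rintro _ ⟨i, rfl⟩
    exact hU i
  · obtain ⟨i, j, hij, h2⟩ := he
    refine ⟨_, ⟨i, rfl⟩, _, ⟨j, rfl⟩, hinj.ne hij, ?_⟩
    rw [subspaceDist, hU, hU, h2]
    omega
  · rintro _ ⟨_, ⟨i, rfl⟩, _, ⟨j, rfl⟩, hij, rfl⟩
    have := h i j fun h' => hij (h' ▸ rfl)
    rw [subspaceDist, hU, hU]
    omega

theorem le_Abar [Finite F] : (Nat.card F) ^ 39 + Nat.card (ExtraIndex F) ≤ Abar F 19 8 6 := by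
  obtain ⟨L, hL2, ⟨g, g', hgg', hLe⟩, hLift⟩ := exists_lifted (F := F)
  obtain ⟨V, hV6, hV2, hVs⟩ := exists_extra (F := F)
  let e := coordSplit F 6 13
  let W : (Fin 3 → Fin 13 → F) ⊕ ExtraIndex F → Submodule F ((Fin 6 → F) × (Fin 13 → F)) :=
    Sum.elim (fun g => graphOf (L g)) V
  let C (i : (Fin 3 → Fin 13 → F) ⊕ ExtraIndex F) : Submodule F (Fin 19 → F) :=
    (W i).map e.toLinearMap
  have hmap (S : Submodule F ((Fin 6 → F) × (Fin 13 → F))) :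
      Module.finrank F (S.map e.toLinearMap) = Module.finrank F S :=
    LinearEquiv.finrank_map_eq e S
  have hinf (i j) : Module.finrank F ↥(C i ⊓ C j) = Module.finrank F ↥(W i ⊓ W j) := by
    rw [← Submodule.map_inf _ e.injective, hmap]
  have hW6 (i) : Module.finrank F (W i) = 6 := by
    rcases i with g | i
    · exact finrank_graphOf _
    · exact hV6 i
  -- A graph has no leading positions in `0 × F^13`, so it meets an added codeword in at most the
  -- dimension of that codeword's plane.
  have hW2 := finrank_inf_sumElim_le hL2 hV2 fun g i => by
    obtain ⟨x, v, hx⟩ := hVs i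
    refine (finrank_inf_le_of_hasShape (hasShape_graphOf (L g)) hx).trans ?_
    rw [top_inf_eq, Finset.empty_inter, Finset.card_empty, add_zero]
    exact (LinearMap.finrank_range_le x).trans (by simp)
  have hC := isCDC_range (U := C) (δ := 4) (by norm_num) (by norm_num)
    (fun i => (hmap _).trans (hW6 i)) (fun i j hij => (hinf i j).trans_le (hW2 i j hij))
    ⟨Sum.inl g, Sum.inl g', Sum.inl_injective.ne hgg', (hinf _ _).trans hLe⟩
  have hcard : Nat.card ((Fin 3 → Fin 13 → F) ⊕ ExtraIndex F) =
      (Nat.card F) ^ 39 + Nat.card (ExtraIndex F) := by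
    rw [Nat.card_sum, Nat.card_fun, Nat.card_fun, ← pow_mul]
    simp
  rw [← hcard]
  refine le_csSup (bddAbove_sizesWithLiftedMRD F 19 8 6) ⟨_, hC, 4, rfl, _, hLift, ?_⟩
  rintro _ ⟨g, rfl⟩
  exact ⟨Sum.inl g, rfl⟩

end Assembly
end ConstDimCode

theorem corollary3p6 (F : Type*) [Field F] [Finite F] (q : ℕ) (hq : Nat.card F = q) :
    (2 < q →
      q ^ 39 + q ^ 27 + q ^ 23 + 2 * q ^ 21 + 3 * q ^ 20 + 4 * q ^ 19 + q ^ 18 + q ^ 17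
        + 2 * q ^ 15 + 2 * q ^ 13 + 2 * q ^ 11 + q ^ 10 + q ^ 9 + 2 * q ^ 7 + q ^ 4 + 1
        ≤ ConstDimCode.Abar F 19 8 6) ∧
    (q = 2 →
      q ^ 39 + q ^ 27 + q ^ 23 + 2 * q ^ 21 + 3 * q ^ 20 + q ^ 19 + q ^ 17
        + 2 * q ^ 15 + 2 * q ^ 13 + 2 * q ^ 11 + q ^ 10 + q ^ 9 + 2 * q ^ 7 + q ^ 4 + 1
        ≤ ConstDimCode.Abar F 19 8 6) := by
  have h := ConstDimCode.le_Abar (F := F)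
  rw [ConstDimCode.card_extraIndex, hq] at h
  constructor
  · intro h2
    -- The code has `2 * q^12` where the claim has `2 * q^11` and lower terms; repeated doubling
    -- absorbs these one power at a time.
    have hmul (n : ℕ) : 2 * q ^ n ≤ q ^ (n + 1) := by
      rw [pow_succ, mul_comm (q ^ n)]
      exact Nat.mul_le_mul_right _ h2.le
    have h4 : 1 ≤ q ^ 4 := Nat.one_le_pow 4 q (by omega)
    have h5 : q ^ 4 ≤ q ^ 7 := Nat.pow_le_pow_right (by omega) (by norm_num)
    have h7 : 2 * q ^ 7 ≤ q ^ 8 := hmul 7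
    have h8 : 2 * q ^ 8 ≤ q ^ 9 := hmul 8
    have h9 : 2 * q ^ 9 ≤ q ^ 10 := hmul 9
    have h10 : 2 * q ^ 10 ≤ q ^ 11 := hmul 10
    have h11 : 2 * q ^ 11 ≤ q ^ 12 := hmul 11
    linarith
  · rintro rfl
    refine le_trans ?_ h
    norm_num
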